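/- Let $\mathcal A$ be an abelian category and let $\mathcal T\subseteq\mathcal A$ be a Serre class, i.e. a full subcategory containing $0$ such that, for every exact sequence $0\to X\to Y\to Z\to 0$ in $\mathcal A$, one has $Y\in\mathcal T$ if and only if $X\in\mathcal T$ and $Z\in\mathcal T$. *Terminology.* A $\mathcal T$-precover of $X$ is a morphism $p:T\to X$ with $T\in\mathcal T$ through which every morphism from an object of $\mathcal T$ to $X$ factors; a $\mathcal T$-preenvelope is the dual notion. $\mathcal T$ is contravariantly (resp. covariantly) finite if every object has a $\mathcal T$-precover (resp. $\mathcal T$-preenvelope), and functorially finite if it is both. The stable category $\underline{\mathcal A}=\mathcal A/\langle\mathcal T\rangle$ has the objects of $\mathcal A$, and its morphisms are those of $\mathcal A$ modulo the ideal $\langle\mathcal T\rangle$ of morphisms that factor through an object of $\mathcal T$; write $\overline f$ for the class of $f$. A category is balanced if every morphism that is both a monomorphism and an epimorphism is an isomorphism. If $\mathcal T$ is contravariantly finite, choose for every object $X$ a $\mathcal T$-precover $p_X:T_X\to X$. The loop functor $\Omega:\underline{\mathcal A}\to\underline{\mathcal A}$ is given on objects by $\Omega X=\ker(p_X)$ and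 on morphisms by lifting along these precovers. Given an exact sequence $0\to K\xrightarrow{i}M\xrightarrow{g}N$ in $\mathcal A$ such that every morphism from an object of $\mathcal T$ to $N$ factors through $g$, a lift $T_N\to M$ of $p_N$ along $g$ induces $h:\Omega N\to K$; the left triangles of $\underline{\mathcal A}$ are the diagrams $\Omega Y\to Z\to X\to Y$ isomorphic to some $\Omega N\xrightarrow{\overline h}K\xrightarrow{\overline i}M\xrightarrow{\overline g}N$ so obtained. A morphism $f:X\to Y$ of $\underline{\mathcal A}$ is a strong monomorphism if there is a left triangle $\Omega Y\to 0\to X\xrightarrow{f}Y$. Dually, if $\mathcal T$ is covariantly finite, cokernels of $\mathcal T$-preenvelopes define the suspension functor $\Sigma$, the right triangles $X\to Y\to Z\to\Sigma X$, and the strong epimorphisms, those $f:X\to Y$ for which there is a right triangle $X\xrightarrow{f}Y\to 0\to\Sigma X$. If $\mathcal T$ is functorially finite, $\underline{\mathcal A}$ is weakly balanced if every morphism that is both a strong monomorphism and a strong epimorphism is an isomorphism. Let $\mathcal T^\perp$ be the full subcategory of all $X\in\mathcal A$ with $\mathcal A(T,X)=0$ for all $T\in\mathcal T$. Write $\mathcal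 A=\mathcal T\oplus\mathcal T^\perp$ if every object of $\mathcal A$ is isomorphic to a direct sum of an object of $\mathcal T$ and an object of $\mathcal T^\perp$, and $\mathcal A(T,F)=0=\mathcal A(F,T)$ for all $T\in\mathcal T$ and $F\in\mathcal T^\perp$. **Statement.** The following assertions are equivalent: 1. $\mathcal T$ is contravariantly finite in $\mathcal A$ and $\underline{\mathcal A}$ is balanced. 1'. $\mathcal T$ is covariantly finite in $\mathcal A$ and $\underline{\mathcal A}$ is balanced. 2. $\mathcal T$ is functorially finite in $\mathcal A$ and $\underline{\mathcal A}$ is weakly balanced. 3. $\mathcal A=\mathcal T\oplus\mathcal T^\perp$. -/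

import Mathlib

open CategoryTheory CategoryTheory.Limits

universe v u

namespace StableCat

section Approximations

variable {A : Type u} [Category.{v} A]

/-- `p : Z ⟶ X` is a `T`-precover of `X`: the object `Z` lies in `T` and every morphism from an
object of `T` to `X` factors through `p`. -/
def IsPrecover (T : ObjectProperty A) {Z X : A} (p : Z ⟶ X) : Prop :=
  T Z ∧ ∀ ⦃W : A⦄, T W → ∀ h : W ⟶ X, ∃ s : W ⟶ Z, s ≫ p = h

/-- `j : X ⟶ Z` is a `T`-preenvelope of `X`: the object `Z` lies in `T` and every morphism from
`X` to an object of `T` factors through `j`. -/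
def IsPreenvelope (T : ObjectProperty A) {X Z : A} (j : X ⟶ Z) : Prop :=
  T Z ∧ ∀ ⦃W : A⦄, T W → ∀ h : X ⟶ W, ∃ s : Z ⟶ W, j ≫ s = h

/-- `T` is contravariantly finite: every object has a `T`-precover. -/
def ContravariantlyFinite (T : ObjectProperty A) : Prop :=
  ∀ X : A, ∃ (Z : A) (p : Z ⟶ X), IsPrecover T p

/-- `T` is covariantly finite: every object has a `T`-preenvelope. -/
def CovariantlyFinite (T : ObjectProperty A) : Prop :=
  ∀ X : A, ∃ (Z : A) (j : X ⟶ Z), IsPreenvelope T j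

/-- A choice of a `T`-precover for every object. -/
structure PrecoverSystem (T : ObjectProperty A) where
  cover : A → A
  p (X : A) : cover X ⟶ X
  isPrecover (X : A) : IsPrecover T (p X)

/-- A choice of a `T`-preenvelope for every object. -/
structure PreenvelopeSystem (T : ObjectProperty A) where
  envelope : A → A
  j (X : A) : X ⟶ envelope X
  isPreenvelope (X : A) : IsPreenvelope T (j X)

/-- A system of precovers for a contravariantly finite `T`. -/
noncomputable def ContravariantlyFinite.system {T : ObjectProperty A}
    (h : ContravariantlyFinite T) : PrecoverSystem T where
  cover X := (h X).choose
  p X := (h X).choose_spec.choose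
  isPrecover X := (h X).choose_spec.choose_spec

/-- A system of preenvelopes for a covariantly finite `T`. -/
noncomputable def CovariantlyFinite.system {T : ObjectProperty A}
    (h : CovariantlyFinite T) : PreenvelopeSystem T where
  envelope X := (h X).choose
  j X := (h X).choose_spec.choose
  isPreenvelope X := (h X).choose_spec.choose_spec

/-- `f` belongs to the ideal `<T>`: it factors through an object of `T`. -/
def FactorsThrough (T : ObjectProperty A) {X Y : A} (f : X ⟶ Y) : Prop :=
  ∃ (Z : A) (_ : T Z) (a : X ⟶ Z) (b : Z ⟶ Y), a ≫ b = f

end Approximations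

section StableCategory

variable {A : Type u} [Category.{v} A] [Preadditive A]

/-- Two parallel morphisms are identified when their difference belongs to `<T>`. -/
def stableRel (T : ObjectProperty A) : HomRel A :=
  fun _ _ f g => FactorsThrough T (f - g)

/-- The stable category `A/<T>`. -/
abbrev Stable (T : ObjectProperty A) : Type u :=
  CategoryTheory.Quotient (stableRel T)

/-- The canonical projection `A ⥤ A/<T>`. -/
abbrev proj (T : ObjectProperty A) : A ⥤ Stable T :=
  CategoryTheory.Quotient.functor (stableRel T)

lemma FactorsThrough.add [HasBinaryBiproducts A] {T : ObjectProperty A}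
    [T.IsClosedUnderBinaryProducts] {X Y : A} {f g : X ⟶ Y}
    (hf : FactorsThrough T f) (hg : FactorsThrough T g) : FactorsThrough T (f + g) := by
  obtain ⟨Z, hZ, a, b, rfl⟩ := hf
  obtain ⟨W, hW, c, d, rfl⟩ := hg
  exact ⟨Z ⊞ W, T.prop_of_isLimit_binaryFan (BinaryBiproduct.isLimit Z W) hZ hW,
    biprod.lift a c, biprod.desc b d, by simp⟩

/-- For an additive subcategory `T`, the morphisms which factor through an object of `T` form a
two-sided ideal, so that `Stable T` has exactly the morphism groups `A(X, Y) / <T>(X, Y)`. -/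
instance stableRel_congruence [HasBinaryBiproducts A] (T : ObjectProperty A)
    [T.ContainsZero] [T.IsClosedUnderBinaryProducts] : Congruence (stableRel T) where
  equivalence :=
    { refl := fun f => by
        obtain ⟨Z, -, hT⟩ := T.exists_prop_of_containsZero
        exact ⟨Z, hT, 0, 0, by simp⟩
      symm := by
        rintro f g ⟨Z, hZ, a, b, h⟩
        exact ⟨Z, hZ, a, -b, by simp [h]⟩
      trans := by
        intro f g k h h'
        have := FactorsThrough.add h h'
        rwa [sub_add_sub_cancel] at this }
  comp_left := by
    rintro X Y W f g g' ⟨Z, hZ, a, b, h⟩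
    exact ⟨Z, hZ, f ≫ a, b, by simp [h]⟩
  comp_right := by
    rintro X Y W f f' g ⟨Z, hZ, a, b, h⟩
    exact ⟨Z, hZ, a, b ≫ g, by rw [← Category.assoc, h, Preadditive.sub_comp]⟩

/-- The addition of the stable category is induced by the addition of morphisms of `A`. -/
instance stablePreadditive [HasBinaryBiproducts A] (T : ObjectProperty A)
    [T.ContainsZero] [T.IsClosedUnderBinaryProducts] : Preadditive (Stable T) :=
  CategoryTheory.Quotient.preadditive (stableRel T) fun _ _ f₁ f₂ g₁ g₂ hf hg => by
    have := FactorsThrough.add hf hg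
    rwa [← add_sub_add_comm] at this

/-- A Serre class is closed under finite direct sums. -/
instance serre_closedUnderBinaryProducts {B : Type u} [Category.{v} B] [Abelian B]
    (T : ObjectProperty B) [T.IsSerreClass] : T.IsClosedUnderBinaryProducts :=
  .mk' (by
    rintro _ ⟨F, hF⟩
    have e : limit F ≅ F.obj ⟨.left⟩ ⊞ F.obj ⟨.right⟩ :=
      (HasLimit.isoOfNatIso (diagramIsoPair F)).trans (biprod.isoProd _ _).symm
    refine T.prop_of_iso e.symm ?_
    exact T.prop_X₂_of_exact (S := ShortComplex.mk (biprod.inl : F.obj ⟨.left⟩ ⟶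
      F.obj ⟨.left⟩ ⊞ F.obj ⟨.right⟩) biprod.snd (by simp))
      (ShortComplex.Splitting.ofHasBinaryBiproduct _ _).exact (hF _) (hF _))

end StableCategory

section Triangles

variable {C : Type u} [Category.{v} C]

/-- A diagram `ΩY ⟶ Z ⟶ X ⟶ Y`. -/
structure LeftTriangle (Ω : C ⥤ C) where
  Z : C
  X : C
  Y : C
  u : Ω.obj Y ⟶ Z
  v : Z ⟶ X
  w : X ⟶ Y

/-- A diagram `X ⟶ Y ⟶ Z ⟶ SX`. -/
structure RightTriangle (S : C ⥤ C) where
  X : C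
  Y : C
  Z : C
  u : X ⟶ Y
  v : Y ⟶ Z
  w : Z ⟶ S.obj X

/-- Isomorphism of diagrams `ΩY ⟶ Z ⟶ X ⟶ Y`; on the first term it is `Ω` of the isomorphism on
the last one. -/
def LeftTriangle.IsIsomorphic {Ω : C ⥤ C} (t t' : LeftTriangle Ω) : Prop :=
  ∃ (α : t.Z ≅ t'.Z) (β : t.X ≅ t'.X) (γ : t.Y ≅ t'.Y),
    t.u ≫ α.hom = Ω.map γ.hom ≫ t'.u ∧ t.v ≫ β.hom = α.hom ≫ t'.v ∧
      t.w ≫ γ.hom = β.hom ≫ t'.w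

/-- Isomorphism of diagrams `X ⟶ Y ⟶ Z ⟶ SX`; on the last term it is `S` of the isomorphism on
the first one. -/
def RightTriangle.IsIsomorphic {S : C ⥤ C} (t t' : RightTriangle S) : Prop :=
  ∃ (α : t.X ≅ t'.X) (β : t.Y ≅ t'.Y) (γ : t.Z ≅ t'.Z),
    t.u ≫ β.hom = α.hom ≫ t'.u ∧ t.v ≫ γ.hom = β.hom ≫ t'.v ∧
      t.w ≫ S.map α.hom = γ.hom ≫ t'.w

/-- Given the class `Δ` of left triangles, `f : X ⟶ Y` is a strong monomorphism if there is a left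
triangle `ΩY ⟶ 0 ⟶ X ⟶ Y` ending in `f`. -/
def IsStrongMono {Ω : C ⥤ C} (Δ : LeftTriangle Ω → Prop) {X Y : C} (f : X ⟶ Y) : Prop :=
  ∃ (Z : C) (_ : IsZero Z) (a : Ω.obj Y ⟶ Z) (b : Z ⟶ X), Δ ⟨Z, X, Y, a, b, f⟩

/-- Given the class `Δ` of right triangles, `f : X ⟶ Y` is a strong epimorphism if there is a right
triangle `X ⟶ Y ⟶ 0 ⟶ SX` starting with `f`. -/
def IsStrongEpi {S : C ⥤ C} (Δ : RightTriangle S → Prop) {X Y : C} (f : X ⟶ Y) : Prop :=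
  ∃ (Z : C) (_ : IsZero Z) (a : Y ⟶ Z) (b : Z ⟶ S.obj X), Δ ⟨X, Y, Z, f, a, b⟩

/-- Weak balance with respect to given classes of left and right triangles. -/
def IsWeaklyBalanced {Ω S : C ⥤ C} (Δl : LeftTriangle Ω → Prop)
    (Δr : RightTriangle S → Prop) : Prop :=
  ∀ ⦃X Y : C⦄ (f : X ⟶ Y), IsStrongMono Δl f → IsStrongEpi Δr f → IsIso f

end Triangles

section Loop

variable {A : Type u} [Category.{v} A] [Abelian A] {T : ObjectProperty A} (P : PrecoverSystem T)

/-- `c : ΩX ⟶ ΩY` is induced by `f : X ⟶ Y` if both are part of a morphism between the sequences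
`ΩX ⟶ T_X ⟶ X` and `ΩY ⟶ T_Y ⟶ Y`. -/
def LoopInduces {X Y : A} (f : X ⟶ Y) (c : kernel (P.p X) ⟶ kernel (P.p Y)) : Prop :=
  ∃ s : P.cover X ⟶ P.cover Y, s ≫ P.p Y = P.p X ≫ f ∧
    c ≫ kernel.ι (P.p Y) = kernel.ι (P.p X) ≫ s

lemma exists_loopInduces {X Y : A} (f : X ⟶ Y) : ∃ c, LoopInduces P f c := by
  obtain ⟨s, hs⟩ := (P.isPrecover Y).2 (P.isPrecover X).1 (P.p X ≫ f)
  exact ⟨kernel.lift _ (kernel.ι _ ≫ s) (by simp [hs]), s, hs, by simp⟩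

/-- A morphism `ΩX ⟶ ΩY` induced by `f`; its class in the stable category does not depend on the
choice. -/
noncomputable def loopHom {X Y : A} (f : X ⟶ Y) : kernel (P.p X) ⟶ kernel (P.p Y) :=
  (exists_loopInduces P f).choose

lemma loopHom_spec {X Y : A} (f : X ⟶ Y) : LoopInduces P f (loopHom P f) :=
  (exists_loopInduces P f).choose_spec

lemma LoopInduces.map_eq {X Y : A} {f g : X ⟶ Y} {c d : kernel (P.p X) ⟶ kernel (P.p Y)}
    (hc : LoopInduces P f c) (hd : LoopInduces P g d) (h : stableRel T f g) :
    (proj T).map c = (proj T).map d := by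
  obtain ⟨s, hs, hcs⟩ := hc
  obtain ⟨t, ht, hdt⟩ := hd
  obtain ⟨Z, hZ, a, b, hab⟩ := h
  obtain ⟨b', hb'⟩ := (P.isPrecover Y).2 hZ b
  apply CategoryTheory.Quotient.sound
  refine ⟨P.cover X, (P.isPrecover X).1, kernel.ι _,
    kernel.lift (P.p Y) (s - t - P.p X ≫ a ≫ b') (by simp [hs, ht, hb', hab]), ?_⟩
  rw [← cancel_mono (kernel.ι (P.p Y))]
  simp [hcs, hdt]

/-- The loop functor `Ω` of the stable category: on objects it is the kernel of the chosen
`T`-precover. -/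
noncomputable def loop : Stable T ⥤ Stable T :=
  CategoryTheory.Quotient.lift _
    { obj := fun X => (proj T).obj (kernel (P.p X))
      map := fun f => (proj T).map (loopHom P f)
      map_id := fun X => by
        rw [← CategoryTheory.Functor.map_id]
        exact LoopInduces.map_eq P (loopHom_spec P (𝟙 X)) (g := 𝟙 X)
          ⟨𝟙 _, by simp, by simp⟩
          ⟨P.cover X, (P.isPrecover X).1, 0, 0, by simp⟩
      map_comp := fun {X Y Z} f g => by
        rw [← CategoryTheory.Functor.map_comp]
        obtain ⟨s, hs, hs'⟩ := loopHom_spec P f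
        obtain ⟨t, ht, ht'⟩ := loopHom_spec P g
        refine LoopInduces.map_eq P (loopHom_spec P (f ≫ g)) (g := f ≫ g)
          ⟨s ≫ t, by simp [ht, reassoc_of% hs], by simp [ht', reassoc_of% hs']⟩
          ⟨P.cover X, (P.isPrecover X).1, 0, 0, by simp⟩ }
    (fun _ _ f g h => LoopInduces.map_eq P (loopHom_spec P f) (loopHom_spec P g) h)

/-- The diagram `ΩN ⟶ K ⟶ M ⟶ N` in the stable category given by `K ⟶ M ⟶ N` and a morphism from
the kernel of the chosen precover of `N` to `K`. -/
noncomputable def mkLeftTriangle (E : ShortComplex A) (h : kernel (P.p E.X₃) ⟶ E.X₁) :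
    LeftTriangle (loop P) where
  Z := (proj T).obj E.X₁
  X := (proj T).obj E.X₂
  Y := (proj T).obj E.X₃
  u := (proj T).map h
  v := (proj T).map E.f
  w := (proj T).map E.g

/-- The left triangles of the stable category: the diagrams isomorphic to one that comes from an
exact sequence `0 ⟶ K ⟶ M ⟶ N` in `A` such that every morphism from an object of `T` to `N`
factors through `M ⟶ N`, with `ΩN ⟶ K` induced by a lift `T_N ⟶ M` of the precover `T_N ⟶ N`. -/
def IsLeftTriangle (t : LeftTriangle (loop P)) : Prop :=
  ∃ (E : ShortComplex A) (_ : E.Exact) (_ : Mono E.f)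
    (_ : ∀ ⦃W : A⦄, T W → ∀ k : W ⟶ E.X₃, ∃ l : W ⟶ E.X₂, l ≫ E.g = k)
    (s : P.cover E.X₃ ⟶ E.X₂) (_ : s ≫ E.g = P.p E.X₃)
    (h : kernel (P.p E.X₃) ⟶ E.X₁) (_ : h ≫ E.f = kernel.ι (P.p E.X₃) ≫ s),
    t.IsIsomorphic (mkLeftTriangle P E h)

end Loop

section Suspension

variable {A : Type u} [Category.{v} A] [Abelian A] {T : ObjectProperty A}
  (Q : PreenvelopeSystem T)

/-- `c : ΣX ⟶ ΣY` is induced by `f : X ⟶ Y` if both are part of a morphism between the sequences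
`X ⟶ T^X ⟶ ΣX` and `Y ⟶ T^Y ⟶ ΣY`. -/
def SuspensionInduces {X Y : A} (f : X ⟶ Y) (c : cokernel (Q.j X) ⟶ cokernel (Q.j Y)) : Prop :=
  ∃ s : Q.envelope X ⟶ Q.envelope Y, Q.j X ≫ s = f ≫ Q.j Y ∧
    cokernel.π (Q.j X) ≫ c = s ≫ cokernel.π (Q.j Y)

lemma exists_suspensionInduces {X Y : A} (f : X ⟶ Y) : ∃ c, SuspensionInduces Q f c := by
  obtain ⟨s, hs⟩ := (Q.isPreenvelope X).2 (Q.isPreenvelope Y).1 (f ≫ Q.j Y)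
  exact ⟨cokernel.desc _ (s ≫ cokernel.π _) (by simp [reassoc_of% hs]), s, hs, by simp⟩

/-- A morphism `ΣX ⟶ ΣY` induced by `f`; its class in the stable category does not depend on the
choice. -/
noncomputable def suspensionHom {X Y : A} (f : X ⟶ Y) : cokernel (Q.j X) ⟶ cokernel (Q.j Y) :=
  (exists_suspensionInduces Q f).choose

lemma suspensionHom_spec {X Y : A} (f : X ⟶ Y) : SuspensionInduces Q f (suspensionHom Q f) :=
  (exists_suspensionInduces Q f).choose_spec

lemma SuspensionInduces.map_eq {X Y : A} {f g : X ⟶ Y}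
    {c d : cokernel (Q.j X) ⟶ cokernel (Q.j Y)}
    (hc : SuspensionInduces Q f c) (hd : SuspensionInduces Q g d) (h : stableRel T f g) :
    (proj T).map c = (proj T).map d := by
  obtain ⟨s, hs, hcs⟩ := hc
  obtain ⟨t, ht, hdt⟩ := hd
  obtain ⟨Z, hZ, a, b, hab⟩ := h
  obtain ⟨a', ha'⟩ := (Q.isPreenvelope X).2 hZ a
  apply CategoryTheory.Quotient.sound
  refine ⟨Q.envelope Y, (Q.isPreenvelope Y).1,
    cokernel.desc (Q.j X) (s - t - a' ≫ b ≫ Q.j Y)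
      (by simp [hs, ht, reassoc_of% ha', reassoc_of% hab]), cokernel.π _, ?_⟩
  rw [← cancel_epi (cokernel.π (Q.j X))]
  simp [hcs, hdt]

/-- The suspension functor `Σ` of the stable category: on objects it is the cokernel of the chosen
`T`-preenvelope. -/
noncomputable def suspension : Stable T ⥤ Stable T :=
  CategoryTheory.Quotient.lift _
    { obj := fun X => (proj T).obj (cokernel (Q.j X))
      map := fun f => (proj T).map (suspensionHom Q f)
      map_id := fun X => by
        rw [← CategoryTheory.Functor.map_id]
        exact SuspensionInduces.map_eq Q (suspensionHom_spec Q (𝟙 X)) (g := 𝟙 X)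
          ⟨𝟙 _, by simp, by simp⟩
          ⟨Q.envelope X, (Q.isPreenvelope X).1, 0, 0, by simp⟩
      map_comp := fun {X Y Z} f g => by
        rw [← CategoryTheory.Functor.map_comp]
        obtain ⟨s, hs, hs'⟩ := suspensionHom_spec Q f
        obtain ⟨t, ht, ht'⟩ := suspensionHom_spec Q g
        refine SuspensionInduces.map_eq Q (suspensionHom_spec Q (f ≫ g)) (g := f ≫ g)
          ⟨s ≫ t, by simp [ht, reassoc_of% hs], by simp [ht', reassoc_of% hs']⟩
          ⟨Q.envelope X, (Q.isPreenvelope X).1, 0, 0, by simp⟩ }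
    (fun _ _ f g h => SuspensionInduces.map_eq Q (suspensionHom_spec Q f)
      (suspensionHom_spec Q g) h)

/-- The diagram `K ⟶ M ⟶ N ⟶ ΣK` in the stable category given by `K ⟶ M ⟶ N` and a morphism from
`N` to the cokernel of the chosen preenvelope of `K`. -/
noncomputable def mkRightTriangle (E : ShortComplex A) (h : E.X₃ ⟶ cokernel (Q.j E.X₁)) :
    RightTriangle (suspension Q) where
  X := (proj T).obj E.X₁
  Y := (proj T).obj E.X₂
  Z := (proj T).obj E.X₃
  u := (proj T).map E.f
  v := (proj T).map E.g
  w := (proj T).map h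

/-- The right triangles of the stable category: the diagrams isomorphic to one that comes from an
exact sequence `K ⟶ M ⟶ N ⟶ 0` in `A` such that every morphism from `K` to an object of `T`
factors through `K ⟶ M`, with `N ⟶ ΣK` induced by an extension `M ⟶ T^K` of the preenvelope
`K ⟶ T^K`. -/
def IsRightTriangle (t : RightTriangle (suspension Q)) : Prop :=
  ∃ (E : ShortComplex A) (_ : E.Exact) (_ : Epi E.g)
    (_ : ∀ ⦃W : A⦄, T W → ∀ k : E.X₁ ⟶ W, ∃ l : E.X₂ ⟶ W, E.f ≫ l = k)
    (s : E.X₂ ⟶ Q.envelope E.X₁) (_ : E.f ≫ s = Q.j E.X₁)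
    (h : E.X₃ ⟶ cokernel (Q.j E.X₁)) (_ : E.g ≫ h = s ≫ cokernel.π (Q.j E.X₁)),
    t.IsIsomorphic (mkRightTriangle Q E h)

end Suspension

/-- Weak balance of the stable category of an abelian category modulo a functorially finite `T`,
for its left and right triangulated structures. -/
def StableIsWeaklyBalanced {A : Type u} [Category.{v} A] [Abelian A] {T : ObjectProperty A}
    (hc : ContravariantlyFinite T) (hd : CovariantlyFinite T) : Prop :=
  IsWeaklyBalanced (IsLeftTriangle hc.system) (IsRightTriangle hd.system)

/-- The additive category `C` is the direct sum of its full subcategories `D` and `E`. -/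
def IsDirectSum {C : Type u} [Category.{v} C] [Preadditive C] [HasBinaryBiproducts C]
    (D E : ObjectProperty C) : Prop :=
  (∀ X : C, ∃ (M N : C), D M ∧ E N ∧ Nonempty (X ≅ M ⊞ N)) ∧
    ∀ ⦃M N : C⦄, D M → E N → (∀ f : M ⟶ N, f = 0) ∧ (∀ f : N ⟶ M, f = 0)

end StableCat

namespace StableCat

/-! ### Monomorphisms, epimorphisms and their strong versions in the stable category -/

section Stable

variable {A : Type u} [Category.{v} A] [Abelian A] {T : ObjectProperty A}

/-! Each of the first three conditions is used only through `InvertsIsoModSerre`. A morphism with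
kernel in `T` becomes both a monomorphism and a strong monomorphism in the stable category, and
dually for cokernels, so either form of balance inverts morphisms with kernel and cokernel in `T`.

The inverse of such a morphism lifts to `A`, where it is an inverse up to maps factoring through
`T`. When the relevant object has no maps from `T`, or none to `T`, this error vanishes and the lift
is a genuine section or retraction. Applied to `X ⟶ X / im p` for a precover `p`, or to `ker j ⟶ X`
for a preenvelope `j`, this splits `X`. Applied to kernels of maps `F ⟶ W` with `F` torsionfree and
`W` in `T`, it gives the missing orthogonality.

Conversely, under a direct sum decomposition every stable object comes from a torsionfree one, and
between torsionfree objects a stable mono-epi is already a mono-epi in `A`. Since strong monos and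
epis are monos and epis (`mono_of_isStrongMono`, `epi_of_isStrongEpi`), balance implies weak
balance. -/

lemma FactorsThrough.eq_zero_of_forall_left {X Y : A} {f : X ⟶ Y} (hf : FactorsThrough T f)
    (hX : ∀ ⦃W : A⦄, T W → ∀ g : X ⟶ W, g = 0) : f = 0 := by
  obtain ⟨Z, hZ, a, b, rfl⟩ := hf
  rw [hX hZ a, zero_comp]

lemma FactorsThrough.eq_zero_of_forall_right {X Y : A} {f : X ⟶ Y} (hf : FactorsThrough T f)
    (hY : ∀ ⦃W : A⦄, T W → ∀ g : W ⟶ Y, g = 0) : f = 0 := by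
  obtain ⟨Z, hZ, a, b, rfl⟩ := hf
  rw [hY hZ b, comp_zero]

variable [T.IsSerreClass]

instance proj_additive : (proj T).Additive where
  map_add := rfl

lemma proj_map_eq_iff {X Y : A} {f g : X ⟶ Y} :
    (proj T).map f = (proj T).map g ↔ FactorsThrough T (f - g) :=
  CategoryTheory.Quotient.functor_map_eq_iff _ _ _

lemma proj_map_eq_zero_iff {X Y : A} {f : X ⟶ Y} :
    (proj T).map f = 0 ↔ FactorsThrough T f := by
  rw [← (proj T).map_zero, proj_map_eq_iff, sub_zero]

lemma isZero_proj_obj {X : A} (hX : T X) : IsZero ((proj T).obj X) := by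
  rw [IsZero.iff_id_eq_zero, ← (proj T).map_id, proj_map_eq_zero_iff]
  exact ⟨X, hX, 𝟙 _, 𝟙 _, by simp⟩

/-- An object mapping to an object of `T` with kernel in `T` belongs to `T`. -/
lemma prop_of_kernel {X Y : A} (f : X ⟶ Y) (hk : T (kernel f)) (hY : T Y) : T X :=
  T.prop_X₂_of_exact (ShortComplex.exact_kernel f) hk hY

lemma prop_of_cokernel {X Y : A} (f : X ⟶ Y) (hk : T (cokernel f)) (hX : T X) : T Y :=
  T.prop_X₂_of_exact (ShortComplex.exact_cokernel f) hX hk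

/-- For a commutative square whose two projections are jointly monic, the corner belongs to `T` if
`Z` and the kernel of `f` do. -/
lemma prop_of_jointly_mono {P X Y Z : A} (f : X ⟶ Y) (hf : T (kernel f)) (hZ : T Z)
    (a : P ⟶ X) (b : P ⟶ Z) (g : Z ⟶ Y) (w : a ≫ f = b ≫ g)
    (hab : ∀ ⦃W : A⦄ (k : W ⟶ P), k ≫ a = 0 → k ≫ b = 0 → k = 0) : T P := by
  refine prop_of_kernel b ?_ hZ
  have hw : (kernel.ι b ≫ a) ≫ f = 0 := by
    rw [Category.assoc, w, kernel.condition_assoc, zero_comp]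
  -- Joint monicity makes `kernel b` a subobject of `kernel f`.
  have : Mono (kernel.lift f (kernel.ι b ≫ a) hw) := by
    refine Preadditive.mono_of_cancel_zero _ fun k hk => ?_
    rw [← cancel_mono (kernel.ι b), zero_comp]
    refine hab _ ?_ (by simp)
    simpa using hk =≫ kernel.ι f
  exact T.prop_of_mono (kernel.lift f _ hw) hf

lemma prop_of_jointly_epi {P X Y Z : A} (f : X ⟶ Y) (hf : T (cokernel f)) (hZ : T Z)
    (a : Y ⟶ P) (b : Z ⟶ P) (g : X ⟶ Z) (w : f ≫ a = g ≫ b)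
    (hab : ∀ ⦃W : A⦄ (k : P ⟶ W), a ≫ k = 0 → b ≫ k = 0 → k = 0) : T P := by
  refine prop_of_cokernel b ?_ hZ
  have hw : f ≫ a ≫ cokernel.π b = 0 := by
    rw [reassoc_of% w, cokernel.condition, comp_zero]
  have : Epi (cokernel.desc f (a ≫ cokernel.π b) hw) := by
    refine Preadditive.epi_of_cancel_zero _ fun k hk => ?_
    rw [← cancel_epi (cokernel.π b), comp_zero]
    refine hab _ ?_ (by simp)
    simpa using cokernel.π f ≫= hk
  exact T.prop_of_epi (cokernel.desc f _ hw) hf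

lemma prop_pullback {X Y Z : A} (f : X ⟶ Y) (g : Z ⟶ Y) (hf : T (kernel f)) (hZ : T Z) :
    T (pullback f g) :=
  prop_of_jointly_mono f hf hZ (pullback.fst f g) (pullback.snd f g) g pullback.condition
    fun _ _ h h' => pullback.hom_ext (by rw [h, zero_comp]) (by rw [h', zero_comp])

lemma prop_pushout {X Y Z : A} (f : X ⟶ Y) (g : X ⟶ Z) (hf : T (cokernel f)) (hZ : T Z) :
    T (pushout f g) :=
  prop_of_jointly_epi f hf hZ (pushout.inl f g) (pushout.inr f g) g pushout.condition
    fun _ _ h h' => pushout.hom_ext (by rw [h, comp_zero]) (by rw [h', comp_zero])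

/-- If `k ≫ f` factors through `b : Z ⟶ Y` with `Z` in `T`, then `k` factors through the pullback of
`f` and `b`, which is again in `T`. -/
lemma mono_proj_map {X Y : A} (f : X ⟶ Y) (hf : T (kernel f)) : Mono ((proj T).map f) := by
  refine Preadditive.mono_of_cancel_zero _ fun {W} k hk => ?_
  obtain ⟨k, rfl⟩ := (proj T).map_surjective (X := W.as) k
  rw [← (proj T).map_comp, proj_map_eq_zero_iff] at hk
  obtain ⟨Z, hZ, a, b, hab⟩ := hk
  exact proj_map_eq_zero_iff.2 ⟨_, prop_pullback f b hf hZ, pullback.lift k a hab.symm,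
    pullback.fst f b, pullback.lift_fst _ _ _⟩

lemma epi_proj_map {X Y : A} (f : X ⟶ Y) (hf : T (cokernel f)) : Epi ((proj T).map f) := by
  refine Preadditive.epi_of_cancel_zero _ fun {W} k hk => ?_
  obtain ⟨k, rfl⟩ := (proj T).map_surjective (Y := W.as) k
  rw [← (proj T).map_comp, proj_map_eq_zero_iff] at hk
  obtain ⟨Z, hZ, a, b, hab⟩ := hk
  exact proj_map_eq_zero_iff.2 ⟨_, prop_pushout f a hf hZ, pushout.inl f a,
    pushout.desc k b hab.symm, pushout.inl_desc _ _ _⟩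

/-- Adding a summand in `T` does not change an object of the stable category. -/
@[simps]
noncomputable def projBiprodIso (X : A) {Z : A} (hZ : T Z) :
    (proj T).obj X ≅ (proj T).obj (X ⊞ Z) where
  hom := (proj T).map biprod.inl
  inv := (proj T).map biprod.fst
  hom_inv_id := by rw [← (proj T).map_comp, biprod.inl_fst, (proj T).map_id]
  inv_hom_id := by
    rw [← (proj T).map_comp, ← (proj T).map_id, proj_map_eq_iff]
    refine ⟨Z, hZ, biprod.snd, -biprod.inr, ?_⟩
    rw [Preadditive.comp_neg, neg_eq_iff_add_eq_zero, ← biprod.total]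
    abel

/-- A morphism with kernel in `T` is a strong monomorphism in the stable category. -/
lemma isStrongMono_proj_map (P : PrecoverSystem T) {X Y : A} (f : X ⟶ Y) (hf : T (kernel f)) :
    IsStrongMono (IsLeftTriangle P) ((proj T).map f) := by
  -- This kernel is the pullback of `f` and `-P.p Y`, hence the sign.
  have hK : T (kernel (biprod.desc f (P.p Y))) := by
    refine prop_of_jointly_mono f hf (P.isPrecover Y).1 (kernel.ι _ ≫ biprod.fst)
      (kernel.ι _ ≫ biprod.snd) (-P.p Y) ?_ fun W k h h' => ?_
    · have : kernel.ι (biprod.desc f (P.p Y)) ≫ biprod.fst ≫ f +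
          kernel.ι (biprod.desc f (P.p Y)) ≫ biprod.snd ≫ P.p Y = 0 := by
        rw [← Preadditive.comp_add, ← biprod.desc_eq, kernel.condition]
      simpa using eq_neg_of_add_eq_zero_left this
    · rw [← cancel_mono (kernel.ι _), zero_comp]
      exact biprod.hom_ext _ _ (by simpa using h) (by simpa using h')
  -- Maps from `T` need not lift along `f`, but they lift along `(f, P.p Y)`, which is stably
  -- isomorphic to `f` because the added summand is in `T`.
  let E : ShortComplex A := ShortComplex.mk (kernel.ι (biprod.desc f (P.p Y)))
    (biprod.desc f (P.p Y)) (by simp)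
  let h : kernel (P.p Y) ⟶ E.X₁ :=
    kernel.lift _ (kernel.ι (P.p Y) ≫ biprod.inr) (by simp)
  let β := projBiprodIso X (P.isPrecover Y).1
  refine ⟨(proj T).obj E.X₁, isZero_proj_obj hK, (proj T).map h,
    (proj T).map E.f ≫ β.inv, E, ShortComplex.exact_kernel _,
    inferInstanceAs (Mono (kernel.ι _)), ?_, biprod.inr, by simp [E], h, by simp [E, h],
    Iso.refl _, β, Iso.refl _, ?_, ?_, ?_⟩
  · intro W hW k
    obtain ⟨l, hl⟩ := (P.isPrecover Y).2 hW k
    exact ⟨l ≫ biprod.inr, by simpa [E] using hl⟩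
  · exact (Category.comp_id ((proj T).map h)).trans
      (((loop P).map_id _ =≫ (proj T).map h).trans (Category.id_comp ((proj T).map h))).symm
  · change ((proj T).map E.f ≫ β.inv) ≫ β.hom = 𝟙 ((proj T).obj E.X₁) ≫ (proj T).map E.f
    rw [Category.assoc, β.inv_hom_id, Category.comp_id, Category.id_comp]
  · change (proj T).map f ≫ 𝟙 ((proj T).obj Y) = (proj T).map biprod.inl ≫ (proj T).map E.g
    rw [Category.comp_id, ← (proj T).map_comp, biprod.inl_desc]

/-- A morphism with cokernel in `T` is a strong epimorphism in the stable category. -/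
lemma isStrongEpi_proj_map (Q : PreenvelopeSystem T) {X Y : A} (f : X ⟶ Y)
    (hf : T (cokernel f)) : IsStrongEpi (IsRightTriangle Q) ((proj T).map f) := by
  have hK : T (cokernel (biprod.lift f (Q.j X))) := by
    refine prop_of_jointly_epi f hf (Q.isPreenvelope X).1 (biprod.inl ≫ cokernel.π _)
      (biprod.inr ≫ cokernel.π _) (-Q.j X) ?_ fun W k h h' => ?_
    · have : f ≫ biprod.inl ≫ cokernel.π (biprod.lift f (Q.j X)) +
          Q.j X ≫ biprod.inr ≫ cokernel.π (biprod.lift f (Q.j X)) = 0 := by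
        simp only [← Category.assoc]
        rw [← Preadditive.add_comp, ← biprod.lift_eq, cokernel.condition]
      simpa using eq_neg_of_add_eq_zero_left this
    · rw [← cancel_epi (cokernel.π _), comp_zero]
      exact biprod.hom_ext' _ _ (by simpa using h) (by simpa using h')
  let E : ShortComplex A := ShortComplex.mk (biprod.lift f (Q.j X))
    (cokernel.π (biprod.lift f (Q.j X))) (by simp)
  let h : E.X₃ ⟶ cokernel (Q.j X) :=
    cokernel.desc _ (biprod.snd ≫ cokernel.π (Q.j X)) (by simp)
  let β := projBiprodIso Y (Q.isPreenvelope X).1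
  refine ⟨(proj T).obj E.X₃, isZero_proj_obj hK, β.hom ≫ (proj T).map E.g,
    (proj T).map h, E, ShortComplex.exact_cokernel _,
    inferInstanceAs (Epi (cokernel.π _)), ?_, biprod.snd, by simp [E], h, by simp [E, h],
    Iso.refl _, β, Iso.refl _, ?_, ?_, ?_⟩
  · intro W hW k
    obtain ⟨l, hl⟩ := (Q.isPreenvelope X).2 hW k
    exact ⟨biprod.snd ≫ l, by simpa [E] using hl⟩
  · change (proj T).map f ≫ β.hom = 𝟙 ((proj T).obj X) ≫ (proj T).map E.f
    rw [← Iso.eq_comp_inv, Category.id_comp]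
    change (proj T).map f = (proj T).map E.f ≫ (proj T).map biprod.fst
    rw [← (proj T).map_comp, biprod.lift_fst]
  · change (β.hom ≫ (proj T).map E.g) ≫ 𝟙 ((proj T).obj E.X₃) = β.hom ≫ (proj T).map E.g
    rw [Category.comp_id]
  · exact (((proj T).map h ≫= (suspension Q).map_id _).trans
      (Category.comp_id ((proj T).map h))).trans (Category.id_comp ((proj T).map h)).symm

/-- If `k ≫ E.g` factors as `c ≫ d` through `T`, lift `d` to `l` along `E.g`. Then `k - c ≫ l`
factors through `E.X₁`, which is stably zero, so `k` is stably `c ≫ l`, hence zero. -/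
lemma mono_of_isStrongMono (P : PrecoverSystem T) {X Y : Stable T} {f : X ⟶ Y}
    (hf : IsStrongMono (IsLeftTriangle P) f) : Mono f := by
  obtain ⟨Z, hZ, a, b, E, hE, _, hlift, -, -, h, -, α, β, γ, -, -, hw⟩ := hf
  have hE₁ : IsZero ((proj T).obj E.X₁) := hZ.of_iso α.symm
  have : Mono ((proj T).map E.g) := by
    refine Preadditive.mono_of_cancel_zero _ fun {W} k hk => ?_
    obtain ⟨k, rfl⟩ := (proj T).map_surjective (X := W.as) k
    rw [← (proj T).map_comp, proj_map_eq_zero_iff] at hk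
    obtain ⟨V, hV, c, d, hcd⟩ := hk
    obtain ⟨l, hl⟩ := hlift hV d
    have hkl : (k - c ≫ l) ≫ E.g = 0 := by simp [hl, hcd]
    have h₀ : (proj T).map (k - c ≫ l) = 0 := by
      rw [← hE.lift_f _ hkl, (proj T).map_comp, hE₁.eq_of_tgt ((proj T).map (hE.lift _ hkl)) 0,
        zero_comp]
    rw [(proj T).map_sub, sub_eq_zero] at h₀
    rw [h₀, proj_map_eq_zero_iff]
    exact ⟨V, hV, c, l, rfl⟩
  let β' : X ≅ (proj T).obj E.X₂ := β
  let γ' : Y ≅ (proj T).obj E.X₃ := γ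
  have hw : f ≫ γ'.hom = β'.hom ≫ (proj T).map E.g := hw
  have : Mono (f ≫ γ'.hom) := hw ▸ mono_comp _ _
  exact mono_of_mono f γ'.hom

lemma epi_of_isStrongEpi (Q : PreenvelopeSystem T) {X Y : Stable T} {f : X ⟶ Y}
    (hf : IsStrongEpi (IsRightTriangle Q) f) : Epi f := by
  obtain ⟨Z, hZ, a, b, E, hE, _, hext, -, -, h, -, α, β, γ, hw, -, -⟩ := hf
  have hE₃ : IsZero ((proj T).obj E.X₃) := hZ.of_iso γ.symm
  have : Epi ((proj T).map E.f) := by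
    refine Preadditive.epi_of_cancel_zero _ fun {W} k hk => ?_
    obtain ⟨k, rfl⟩ := (proj T).map_surjective (Y := W.as) k
    rw [← (proj T).map_comp, proj_map_eq_zero_iff] at hk
    obtain ⟨V, hV, c, d, hcd⟩ := hk
    obtain ⟨l, hl⟩ := hext hV c
    have hkl : E.f ≫ (k - l ≫ d) = 0 := by simp [reassoc_of% hl, hcd]
    have h₀ : (proj T).map (k - l ≫ d) = 0 := by
      rw [← hE.g_desc _ hkl, (proj T).map_comp, hE₃.eq_of_src ((proj T).map (hE.desc _ hkl)) 0,
        comp_zero]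
    rw [(proj T).map_sub, sub_eq_zero] at h₀
    rw [h₀, proj_map_eq_zero_iff]
    exact ⟨V, hV, l, d, rfl⟩
  let α' : X ≅ (proj T).obj E.X₁ := α
  let β' : Y ≅ (proj T).obj E.X₂ := β
  have hw : f ≫ β'.hom = α'.hom ≫ (proj T).map E.f := hw
  have hf : f = α'.hom ≫ (proj T).map E.f ≫ β'.inv := by
    rw [← Category.assoc, ← hw, Category.assoc, β'.hom_inv_id, Category.comp_id]
  rw [hf]
  infer_instance

end Stable

/-! ### From inverting isomorphisms modulo `T` to the decomposition -/

section InvertsIsoModSerre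

variable {A : Type u} [Category.{v} A] [Abelian A] {T : ObjectProperty A}

/-- The projection to the stable category inverts the morphisms with kernel and cokernel
in `T`. -/
def InvertsIsoModSerre (T : ObjectProperty A) : Prop :=
  ∀ ⦃X Y : A⦄ (f : X ⟶ Y), T (kernel f) → T (cokernel f) → IsIso ((proj T).map f)

variable [T.IsSerreClass]

lemma invertsIsoModSerre_of_balanced [Balanced (Stable T)] : InvertsIsoModSerre T := by
  intro X Y f hk hc
  have := mono_proj_map f hk
  have := epi_proj_map f hc
  exact isIso_of_mono_of_epi _

lemma invertsIsoModSerre_of_weaklyBalanced (hc : ContravariantlyFinite T)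
    (hd : CovariantlyFinite T) (h : StableIsWeaklyBalanced hc hd) : InvertsIsoModSerre T :=
  fun _ _ f hk hk' => h _ (isStrongMono_proj_map _ f hk) (isStrongEpi_proj_map _ f hk')

/-- An epimorphism with kernel in `T` onto a `T`-torsionfree object splits. -/
lemma InvertsIsoModSerre.exists_section (H : InvertsIsoModSerre T) {X Y : A} (f : X ⟶ Y) [Epi f]
    (hk : T (kernel f)) (hY : ∀ ⦃W : A⦄, T W → ∀ g : W ⟶ Y, g = 0) :
    ∃ s : Y ⟶ X, s ≫ f = 𝟙 Y := by
  have := H f hk (T.prop_of_isZero (isZero_cokernel_of_epi f))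
  obtain ⟨s, hs⟩ := (proj T).map_surjective (inv ((proj T).map f))
  -- The error `s ≫ f - 𝟙 Y` factors through `T` and ends in `Y`, so it is zero.
  refine ⟨s, sub_eq_zero.1 (FactorsThrough.eq_zero_of_forall_right (T := T) ?_ hY)⟩
  rw [← proj_map_eq_iff, (proj T).map_comp, hs, IsIso.inv_hom_id, (proj T).map_id]

/-- A map with kernel in `T` and cokernel in `T` from an object without morphisms to `T` has a
retraction. -/
lemma InvertsIsoModSerre.exists_retraction (H : InvertsIsoModSerre T) {X Y : A} (f : X ⟶ Y)
    (hk : T (kernel f)) (hc : T (cokernel f)) (hX : ∀ ⦃W : A⦄, T W → ∀ g : X ⟶ W, g = 0) :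
    ∃ s : Y ⟶ X, f ≫ s = 𝟙 X := by
  have := H f hk hc
  obtain ⟨s, hs⟩ := (proj T).map_surjective (inv ((proj T).map f))
  refine ⟨s, sub_eq_zero.1 (FactorsThrough.eq_zero_of_forall_left (T := T) ?_ hX)⟩
  rw [← proj_map_eq_iff, (proj T).map_comp, hs, IsIso.hom_inv_id, (proj T).map_id]

/-- The cokernel of `ker f ⟶ F` is the image of `f`, a subobject of `W`, so this inclusion is stably
invertible. As `F` is torsionfree it has a section in `A`, which forces `ker f` to be all of `F`. -/
lemma InvertsIsoModSerre.rightOrthogonal_le (H : InvertsIsoModSerre T) {F : A}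
    (hF : T.rightOrthogonal F) ⦃W : A⦄ (hW : T W) (f : F ⟶ W) : f = 0 := by
  have hι : T (cokernel (kernel.ι f)) :=
    T.prop_of_mono (cokernel.desc (kernel.ι f) f (kernel.condition f)) hW
  have := H (kernel.ι f) (T.prop_of_isZero (isZero_kernel_of_mono _)) hι
  obtain ⟨s, hs⟩ := (proj T).map_surjective (inv ((proj T).map (kernel.ι f)))
  have hs' : s ≫ kernel.ι f = 𝟙 F := by
    refine sub_eq_zero.1 (FactorsThrough.eq_zero_of_forall_right (T := T) ?_
      fun _ hW g => hF g hW)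
    rw [← proj_map_eq_iff, (proj T).map_comp, hs, IsIso.inv_hom_id, (proj T).map_id]
  rw [← Category.id_comp f, ← hs', Category.assoc, kernel.condition, comp_zero]

/-- Here `F ⟶ F / im f` has kernel in `T`, hence a retraction, so `im f` is zero. -/
lemma InvertsIsoModSerre.rightOrthogonal_of_forall (H : InvertsIsoModSerre T) {F : A}
    (hF : ∀ ⦃W : A⦄, T W → ∀ g : F ⟶ W, g = 0) : T.rightOrthogonal F := by
  intro W f hW
  have hπ : T (kernel (cokernel.π f)) :=
    T.prop_of_epi (kernel.lift (cokernel.π f) f (cokernel.condition f)) hW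
  obtain ⟨s, hs⟩ := H.exists_retraction (cokernel.π f) hπ
    (T.prop_of_isZero (isZero_cokernel_of_epi _)) hF
  rw [← Category.comp_id f, ← hs, cokernel.condition_assoc, zero_comp]

lemma isDirectSum_of_exists_iso (H : InvertsIsoModSerre T)
    (h : ∀ X : A, ∃ M N : A, T M ∧ T.rightOrthogonal N ∧ Nonempty (X ≅ M ⊞ N)) :
    IsDirectSum T T.rightOrthogonal :=
  ⟨h, fun _ _ hM hN => ⟨fun f => hN f hM, fun f => H.rightOrthogonal_le hN hM f⟩⟩

lemma InvertsIsoModSerre.isDirectSum_of_contravariantlyFinite (H : InvertsIsoModSerre T)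
    (hT : ContravariantlyFinite T) : IsDirectSum T T.rightOrthogonal := by
  refine isDirectSum_of_exists_iso H fun X => ?_
  obtain ⟨Z, p, hZ, hp⟩ := hT X
  have hk : T (kernel (cokernel.π p)) :=
    T.prop_of_epi (kernel.lift (cokernel.π p) p (cokernel.condition p)) hZ
  have hF : T.rightOrthogonal (cokernel p) := by
    intro W k hW
    -- The pullback is an extension of `W` by the image of `p`, hence in `T`. Its map to `X` thus
    -- factors through `p` and dies in the cokernel; since the pullback maps onto `W`, so does `k`.
    obtain ⟨s, hs⟩ := hp (prop_pullback (cokernel.π p) k hk hW) (pullback.fst _ _)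
    rw [← cancel_epi (pullback.snd (cokernel.π p) k), ← pullback.condition, ← hs]
    simp
  obtain ⟨s, hs⟩ := H.exists_section (cokernel.π p) hk fun _ hW g => hF g hW
  exact ⟨_, _, hk, hF, ⟨(ShortComplex.Splitting.ofExactOfSection _
    (ShortComplex.exact_kernel (cokernel.π p)) s hs
      (inferInstanceAs (Mono (kernel.ι _)))).isoBinaryBiproduct⟩⟩

lemma InvertsIsoModSerre.isDirectSum_of_covariantlyFinite (H : InvertsIsoModSerre T)
    (hT : CovariantlyFinite T) : IsDirectSum T T.rightOrthogonal := by
  refine isDirectSum_of_exists_iso H fun X => ?_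
  obtain ⟨Z, j, hZ, hj⟩ := hT X
  have hk : T (cokernel (kernel.ι j)) :=
    T.prop_of_mono (cokernel.desc (kernel.ι j) j (kernel.condition j)) hZ
  have hF : ∀ ⦃W : A⦄, T W → ∀ g : kernel j ⟶ W, g = 0 := by
    intro W hW k
    -- Dually, `X` maps to the pushout through `j`, so this map kills `ker j`, and `W` embeds in the
    -- pushout.
    obtain ⟨s, hs⟩ := hj (prop_pushout (kernel.ι j) k hk hW) (pushout.inl _ _)
    rw [← cancel_mono (pushout.inr (kernel.ι j) k), ← pushout.condition, ← hs]
    simp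
  obtain ⟨s, hs⟩ := H.exists_retraction (kernel.ι j)
    (T.prop_of_isZero (isZero_kernel_of_mono _)) hk hF
  exact ⟨_, _, hk, H.rightOrthogonal_of_forall hF, ⟨(ShortComplex.Splitting.ofExactOfRetraction _
    (ShortComplex.exact_cokernel (kernel.ι j)) s hs
      (inferInstanceAs (Epi (cokernel.π _)))).isoBinaryBiproduct ≪≫ biprod.braiding _ _⟩⟩

end InvertsIsoModSerre

/-! ### Consequences of the decomposition -/

section DirectSum

variable {A : Type u} [Category.{v} A] [Abelian A] {T : ObjectProperty A}

lemma IsDirectSum.contravariantlyFinite (h : IsDirectSum T T.rightOrthogonal) :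
    ContravariantlyFinite T := by
  intro X
  obtain ⟨M, N, hM, hN, ⟨e⟩⟩ := h.1 X
  refine ⟨M, biprod.inl ≫ e.inv, hM, fun W hW k => ⟨k ≫ e.hom ≫ biprod.fst, ?_⟩⟩
  rw [← cancel_mono e.hom]
  refine biprod.hom_ext _ _ (by simp) ?_
  rw [hN ((k ≫ e.hom) ≫ biprod.snd) hW]
  simp

lemma IsDirectSum.covariantlyFinite (h : IsDirectSum T T.rightOrthogonal) :
    CovariantlyFinite T := by
  intro X
  obtain ⟨M, N, hM, hN, ⟨e⟩⟩ := h.1 X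
  refine ⟨M, e.hom ≫ biprod.fst, hM, fun W hW k => ⟨biprod.inl ≫ e.inv ≫ k, ?_⟩⟩
  rw [← cancel_epi e.inv]
  refine biprod.hom_ext' _ _ (by simp) ?_
  rw [(h.2 hW hN).2 (biprod.inr ≫ e.inv ≫ k)]
  simp

variable [T.IsSerreClass]

/-- Every object of the stable category comes from an object of `T.rightOrthogonal`. -/
lemma IsDirectSum.exists_iso_proj_obj (h : IsDirectSum T T.rightOrthogonal) (X : Stable T) :
    ∃ N : A, T.rightOrthogonal N ∧ Nonempty ((proj T).obj N ≅ X) := by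
  obtain ⟨M, N, hM, hN, ⟨e⟩⟩ := h.1 X.as
  exact ⟨N, hN, ⟨projBiprodIso N hM ≪≫ (proj T).mapIso (biprod.braiding _ _ ≪≫ e.symm)⟩⟩

/-- The projection kills no nonzero map into `X` or out of `Y`, so cancellation against `f` descends
from the stable category to `A`, which is balanced. -/
lemma IsDirectSum.isIso_proj_map (h : IsDirectSum T T.rightOrthogonal) {X Y : A}
    (hX : T.rightOrthogonal X) (hY : T.rightOrthogonal Y) (f : X ⟶ Y)
    [Mono ((proj T).map f)] [Epi ((proj T).map f)] : IsIso f := by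
  have : Mono f := by
    refine Preadditive.mono_of_cancel_zero _ fun k hk => ?_
    have hk' : (proj T).map k = 0 := by
      rw [← cancel_mono ((proj T).map f), ← (proj T).map_comp, hk, (proj T).map_zero, zero_comp]
    exact (proj_map_eq_zero_iff.1 hk').eq_zero_of_forall_right fun _ hW g => hX g hW
  have : Epi f := by
    refine Preadditive.epi_of_cancel_zero _ fun k hk => ?_
    have hk' : (proj T).map k = 0 := by
      rw [← cancel_epi ((proj T).map f), ← (proj T).map_comp, hk, (proj T).map_zero, comp_zero]
    exact (proj_map_eq_zero_iff.1 hk').eq_zero_of_forall_left fun _ hW g => (h.2 hW hY).2 g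
  exact isIso_of_mono_of_epi f

lemma IsDirectSum.balanced (h : IsDirectSum T T.rightOrthogonal) : Balanced (Stable T) where
  isIso_of_mono_of_epi {X Y} f _ _ := by
    obtain ⟨M, hM, ⟨e⟩⟩ := h.exists_iso_proj_obj X
    obtain ⟨N, hN, ⟨e'⟩⟩ := h.exists_iso_proj_obj Y
    obtain ⟨g, hg⟩ := (proj T).map_surjective (e.hom ≫ f ≫ e'.inv)
    have : Mono ((proj T).map g) := hg ▸ inferInstance
    have : Epi ((proj T).map g) := hg ▸ inferInstance
    have := h.isIso_proj_map hM hN g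
    have hf : f = e.inv ≫ (proj T).map g ≫ e'.hom := by simp [hg]
    rw [hf]
    infer_instance

end DirectSum

end StableCat

theorem corollary3p4 {A : Type u} [Category.{v} A] [Abelian A] (T : ObjectProperty A)
    [T.IsSerreClass] :
    List.TFAE [
      StableCat.ContravariantlyFinite T ∧ Balanced (StableCat.Stable T),
      StableCat.CovariantlyFinite T ∧ Balanced (StableCat.Stable T),
      ∃ (hc : StableCat.ContravariantlyFinite T) (hd : StableCat.CovariantlyFinite T),
        StableCat.StableIsWeaklyBalanced hc hd,
      StableCat.IsDirectSum T T.rightOrthogonal] := by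
  tfae_have 1 → 4 := fun ⟨hc, _⟩ =>
    StableCat.invertsIsoModSerre_of_balanced.isDirectSum_of_contravariantlyFinite hc
  tfae_have 2 → 4 := fun ⟨hd, _⟩ =>
    StableCat.invertsIsoModSerre_of_balanced.isDirectSum_of_covariantlyFinite hd
  tfae_have 3 → 4 := fun ⟨hc, hd, h⟩ =>
    (StableCat.invertsIsoModSerre_of_weaklyBalanced hc hd h).isDirectSum_of_contravariantlyFinite hc
  tfae_have 4 → 1 := fun h => ⟨h.contravariantlyFinite, h.balanced⟩
  tfae_have 4 → 2 := fun h => ⟨h.covariantlyFinite, h.balanced⟩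
  tfae_have 4 → 3 := fun h => by
    refine ⟨h.contravariantlyFinite, h.covariantlyFinite, fun X Y f hf hf' => ?_⟩
    have := h.balanced
    have := StableCat.mono_of_isStrongMono _ hf
    have := StableCat.epi_of_isStrongEpi _ hf'
    exact isIso_of_mono_of_epi f
  tfae_finish
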